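/- Let $d\ge 0$, equip $\mathbb{R}^d$ with its Euclidean inner product, and let $f\colon\mathbb{R}^d\to\mathbb{R}$ be locally Lipschitz. The Clarke subdifferential of $f$ at $x$ is $$\partial f(x)=\operatorname{conv}\Big\{\lim_{i\to\infty}\nabla f(x_i)\;:\; x_i\to x,\ f \text{ differentiable at each } x_i,\ \text{the limit exists}\Big\}.$$ A point $x$ is critical for $f$ if $0\in\partial f(x)$; a real number $r$ is a critical value of $f$ if $r=f(x)$ for some critical point $x$, and a noncritical value otherwise. The function $f$ is subdifferentially regular if for every $x$ and every $v\in\partial f(x)$ one has $f(y)\ge f(x)+\langle v,y-x\rangle+o(\|y-x\|)$ as $y\to x$. Suppose that $f$ is locally Lipschitz and subdifferentially regular, and that its set of noncritical values is dense in $\mathbb{R}$. Then the following two statements hold. 1. (Stochastic approximation) Let $(\alpha_k)_{k\ge0}$ be reals and $(x_k),(y_k),(\xi_k)_{k\ge0}$ be sequences in $\mathbb{R}^d$ with $x_{k+1}=x_k+\alpha_k(y_k+\xi_k)$ for all $k$, such that: (a) $(x_k)$ and $(y_k)$ are bounded; (b) $\alpha_k\ge0$, $\sum_k\alpha_k=\infty$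 and $\sum_k\alpha_k^2<\infty$; (c) $\sum_{k<n}\alpha_k\xi_k$ converges in $\mathbb{R}^d$ as $n\to\infty$; (d) for every strictly increasing sequence of indices $(k_j)_{j\ge1}$ such that $x_{k_j}$ converges to some $\bar x$, $\operatorname{dist}\big(\frac1n\sum_{j=1}^n y_{k_j},\,-\partial f(\bar x)\big)\to0$ as $n\to\infty$. Then every limit point of $(x_k)$ is critical for $f$, and the sequence $(f(x_k))$ converges in $\mathbb{R}$. 2. (Stochastic subgradient method) Let $(x_k),(y_k),(\xi_k)_{k\ge0}$ be sequences of $\mathbb{R}^d$-valued random variables on a probability space with $x_{k+1}=x_k-\alpha_k(y_k+\xi_k)$ and $y_k\in\partial f(x_k)$ for all $k$, where the deterministic step-sizes $\alpha_k$ satisfy (b). Suppose that almost surely $\sup_k\|x_k\|<\infty$, and that $(\xi_k)$ is a martingale difference sequence in the following sense: there are an increasing sequence of sub-$\sigma$-algebras $(\mathcal F_k)_{k\ge0}$ with $\sigma(x_j,y_j,\xi_j: j<k)\subseteq\mathcal F_k$ for every $k$ (for instance, equality) and a function $p\colon\mathbb{R}^d\to[0,\infty)$, bounded on bounded sets, such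 that each $\xi_k$ is integrable and, for all $k$, almost surely $$\mathbb{E}[\xi_k\mid\mathcal F_k]=0\qquad\text{and}\qquad \mathbb{E}[\|\xi_k\|^2\mid\mathcal F_k]\le p(x_k).$$ Then, almost surely, every limit point of $(x_k)$ is critical for $f$ and the sequence $(f(x_k))$ converges in $\mathbb{R}$. -/

import Mathlib

open Filter Topology MeasureTheory ProbabilityTheory
open scoped NNReal ENNReal Pointwise

noncomputable section

/-- The Clarke subdifferential of a (locally Lipschitz) function `f` on `ℝ^d` at `x`: the convex
hull of all limits of gradients `∇ f (u i)` along sequences `u i → x` of points of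
differentiability of `f`. -/
def clarkeSubdifferential {d : ℕ} (f : EuclideanSpace ℝ (Fin d) → ℝ)
    (x : EuclideanSpace ℝ (Fin d)) : Set (EuclideanSpace ℝ (Fin d)) :=
  convexHull ℝ {v | ∃ u : ℕ → EuclideanSpace ℝ (Fin d),
    (∀ i, DifferentiableAt ℝ f (u i)) ∧ Tendsto u atTop (𝓝 x) ∧
      Tendsto (fun i => gradient f (u i)) atTop (𝓝 v)}

/-- `x` is (Clarke) critical for `f`. -/
def IsClarkeCritical {d : ℕ} (f : EuclideanSpace ℝ (Fin d) → ℝ)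
    (x : EuclideanSpace ℝ (Fin d)) : Prop :=
  (0 : EuclideanSpace ℝ (Fin d)) ∈ clarkeSubdifferential f x

/-- The set of critical values of `f`. -/
def criticalValues {d : ℕ} (f : EuclideanSpace ℝ (Fin d) → ℝ) : Set ℝ :=
  {r | ∃ x, IsClarkeCritical f x ∧ f x = r}

/-- Subdifferential regularity at `x`: every `v ∈ ∂f(x)` satisfies
`f y ≥ f x + ⟨v, y - x⟩ + o(‖y - x‖)` as `y → x`. -/
def SubdifferentiallyRegularAt {d : ℕ} (f : EuclideanSpace ℝ (Fin d) → ℝ)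
    (x : EuclideanSpace ℝ (Fin d)) : Prop :=
  ∀ v ∈ clarkeSubdifferential f x, ∃ r : EuclideanSpace ℝ (Fin d) → ℝ,
    r =o[𝓝 x] (fun y => y - x) ∧ ∀ᶠ y in 𝓝 x, f x + inner ℝ v (y - x) + r y ≤ f y

/-- Nonnegative, square summable, but not summable step-sizes. -/
structure IsStepSize (α : ℕ → ℝ) : Prop where
  nonneg : ∀ k, 0 ≤ α k
  sum_eq_top : Tendsto (fun n => ∑ k ∈ Finset.range n, α k) atTop atTop
  sq_summable : Summable (fun k => α k ^ 2)

/-- The iteration `x_{k+1} = x_k + α_k (y_k + ξ_k)` together with the standing assumptions of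
stochastic approximation for the set-valued map `G : ℝ^d ⇉ ℝ^d`. (The domain of `G` is the whole
space, so that no condition is needed on where the limit points lie.) -/
structure IsStochasticApproximation {d : ℕ}
    (G : EuclideanSpace ℝ (Fin d) → Set (EuclideanSpace ℝ (Fin d)))
    (α : ℕ → ℝ) (x y ξ : ℕ → EuclideanSpace ℝ (Fin d)) : Prop where
  step : ∀ k, x (k + 1) = x k + α k • (y k + ξ k)
  bounded_x : ∃ C, ∀ k, ‖x k‖ ≤ C
  bounded_y : ∃ C, ∀ k, ‖y k‖ ≤ C
  stepSize : IsStepSize α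
  noise : ∃ v, Tendsto (fun n => ∑ k ∈ Finset.range n, α k • ξ k) atTop (𝓝 v)
  average : ∀ (κ : ℕ → ℕ) (xbar : EuclideanSpace ℝ (Fin d)), StrictMono κ →
    Tendsto (fun j => x (κ j)) atTop (𝓝 xbar) →
    Tendsto (fun n : ℕ => Metric.infDist ((n : ℝ)⁻¹ • ∑ j ∈ Finset.range n, y (κ j)) (G xbar))
      atTop (𝓝 0)

/-- The σ-algebra `σ(x_j, y_j, ξ_j : j < k)` of the past at stage `k`. -/
abbrev pastSigma {Ω : Type*} {d : ℕ} (x y ξ : ℕ → Ω → EuclideanSpace ℝ (Fin d)) (k : ℕ) :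
    MeasurableSpace Ω :=
  ⨆ j, ⨆ _ : j < k,
    (borel (EuclideanSpace ℝ (Fin d))).comap (x j) ⊔
      (borel (EuclideanSpace ℝ (Fin d))).comap (y j) ⊔
      (borel (EuclideanSpace ℝ (Fin d))).comap (ξ j)

/-- The stochastic subgradient method `x_{k+1} = x_k - α_k (y_k + ξ_k)`, `y_k ∈ ∂f(x_k)`, with its
standing assumptions. `ℱ k` is the information available before `ξ_k` is drawn; it contains
`x_j, y_j, ξ_j` for `j < k`. The conditional second moment is the `[0, ∞]`-valued conditional
expectation, so that no integrability of `‖ξ_k‖²` is presupposed. -/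
structure IsStochasticSubgradientMethod {Ω : Type*} {m : MeasurableSpace Ω} (μ : Measure Ω) {d : ℕ}
    (f : EuclideanSpace ℝ (Fin d) → ℝ) (ℱ : Filtration ℕ m)
    (α : ℕ → ℝ) (x y ξ : ℕ → Ω → EuclideanSpace ℝ (Fin d)) : Prop where
  step : ∀ k ω, x (k + 1) ω = x k ω - α k • (y k ω + ξ k ω)
  subgradient : ∀ k ω, y k ω ∈ clarkeSubdifferential f (x k ω)
  stepSize : IsStepSize α
  bounded_x : ∀ᵐ ω ∂μ, ∃ C, ∀ k, ‖x k ω‖ ≤ C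
  past_le : ∀ k, pastSigma x y ξ k ≤ ℱ k
  integrable : ∀ k, Integrable (ξ k) μ
  mean_zero : ∀ k, μ[ξ k | ℱ k] =ᵐ[μ] 0
  second_moment : ∃ p : EuclideanSpace ℝ (Fin d) → ℝ≥0,
    (∀ B : Set (EuclideanSpace ℝ (Fin d)), Bornology.IsBounded B → BddAbove (p '' B)) ∧
    ∀ k, ∀ᵐ ω ∂μ, condLExp (ℱ k) μ (fun ω' => ‖ξ k ω'‖ₑ ^ 2) ω ≤ (p (x k ω) : ℝ≥0∞)

end

/-! Subtracting the convergent noise leaves a sequence `w` with increments `α k • y k` that shadows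
`x`. At a point `a` let `v` be the minimal-norm element of `∂f(a)`; every subgradient `u` there
satisfies `⟨v, u⟩ ≥ ‖v‖²`. By the averaging hypothesis, `⟨v, y i⟩` is then asymptotically at most
`-‖v‖²` while `w i` is near `a` (`IsStochasticApproximation.isAsymptoticDescent`).

Ultrafilter limits of time-shifted interpolations of `w` are Lipschitz curves `z` on the whole line.
Regularity, applied to `v` at `z t` and the earlier point `z (t - h)`, shows that `f ∘ z` drops at
rate at least `‖v‖²` on the left of each `t` (`IsAsymptoticDescent.exists_limit_curve`). Neither a
chain rule nor differentiability of `z` is needed.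

If `f (w k)` diverged, it would cross upwards infinitely often from a noncritical level `a` to some
`b > a`. A limit of the crossings is a curve along which `f` is constantly `a` for a positive time,
so `a` would be critical. Once `f (w k)` converges, `f` is constant on every limit curve, and the
curve through a limit point shows that this point is critical.

For the subgradient method, the noise series converges almost surely by martingale convergence after
truncation to balls, and outer semicontinuity with convexity of `∂f` gives the averaging condition.
-/

/-- In finite dimension, the convex hull of a compact set is compact. -/
theorem isCompact_convexHull_of_finiteDimensional {E : Type*} [NormedAddCommGroup E]
    [NormedSpace ℝ E] [FiniteDimensional ℝ E] {s : Set E} (hs : IsCompact s) :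
    IsCompact (convexHull ℝ s) := by
  rcases s.eq_empty_or_nonempty with rfl | ⟨z₀, hz₀⟩
  · simp
  set n := Module.finrank ℝ E + 1
  have himage : convexHull ℝ s = (fun p : (Fin n → ℝ) × (Fin n → E) => ∑ i, p.1 i • p.2 i) ''
      (stdSimplex ℝ (Fin n) ×ˢ Set.univ.pi fun _ => s) := by
    refine Set.Subset.antisymm (fun x hx => ?_) ?_
    · obtain ⟨ι, _, z, w, hz, hind, hw, hw1, hwz⟩ := eq_pos_convex_span_of_mem_convexHull hx
      have hcard : Fintype.card ι ≤ Fintype.card (Fin n) := by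
        have h1 := hind.card_le_finrank_succ
        have h2 := Submodule.finrank_le (vectorSpan ℝ (Set.range z))
        simp only [Fintype.card_fin, n]
        omega
      obtain ⟨e⟩ := Function.Embedding.nonempty_of_card_le hcard
      -- Carathéodory may give fewer than `n` points; the unused slots receive weight `0` and the
      -- dummy point `z₀`.
      refine ⟨(Function.extend e w 0, Function.extend e z fun _ => z₀), ⟨⟨fun i => ?_, ?_⟩, ?_⟩, ?_⟩
      · by_cases hi : ∃ a, e a = i
        · obtain ⟨a, rfl⟩ := hi
          simpa [e.injective.extend_apply] using (hw a).le
        · simp [Function.extend_apply' _ _ _ hi]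
      · rw [← hw1]
        refine (Fintype.sum_of_injective e e.injective _ _ (fun i hi => ?_) fun i => ?_).symm
        · exact Function.extend_apply' _ _ _ hi
        · simp [e.injective.extend_apply]
      · intro i _
        by_cases hi : ∃ a, e a = i
        · obtain ⟨a, rfl⟩ := hi
          simpa [e.injective.extend_apply] using hz ⟨a, rfl⟩
        · simpa [Function.extend_apply' _ _ _ hi] using hz₀
      · rw [← hwz]
        refine (Fintype.sum_of_injective e e.injective _ _ (fun i hi => ?_) fun i => ?_).symm
        · have hi' : ¬∃ a, e a = i := hi
          simp [Function.extend_apply' _ _ _ hi']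
        · simp [e.injective.extend_apply]
    · rintro _ ⟨⟨w, z⟩, ⟨hw, hz⟩, rfl⟩
      exact (convex_convexHull ℝ s).sum_mem (fun i _ => hw.1 i) hw.2
        fun i _ => subset_convexHull ℝ s (hz i (Set.mem_univ i))
  rw [himage]
  exact ((isCompact_stdSimplex ℝ _).prod (isCompact_univ_pi fun _ => hs)).image (by fun_prop)

/-! ### Compactness, nonemptiness and outer semicontinuity of the Clarke subdifferential. -/

section ClarkeSubdifferential

variable {d : ℕ} {f : EuclideanSpace ℝ (Fin d) → ℝ}

/-- The closure of the graph of the gradient over the points of differentiability. -/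
def gradientGraphClosure (f : EuclideanSpace ℝ (Fin d) → ℝ) :
    Set (EuclideanSpace ℝ (Fin d) × EuclideanSpace ℝ (Fin d)) :=
  closure {p | DifferentiableAt ℝ f p.1 ∧ gradient f p.1 = p.2}

/-- The limiting gradients form a slice of a closed set, so compactness and semicontinuity become
closed-graph arguments. -/
theorem clarkeSubdifferential_eq_convexHull (f : EuclideanSpace ℝ (Fin d) → ℝ)
    (x : EuclideanSpace ℝ (Fin d)) :
    clarkeSubdifferential f x = convexHull ℝ {v | (x, v) ∈ gradientGraphClosure f} := by
  unfold clarkeSubdifferential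
  congr 1
  ext v
  simp only [gradientGraphClosure, Set.mem_ofPred_eq, mem_closure_iff_seq_limit]
  constructor
  · rintro ⟨u, hu, hux, huv⟩
    exact ⟨fun i => (u i, gradient f (u i)), fun i => ⟨hu i, rfl⟩, hux.prodMk_nhds huv⟩
  · rintro ⟨p, hp, hpx⟩
    refine ⟨fun i => (p i).1, fun i => (hp i).1, (continuous_fst.tendsto _).comp hpx, ?_⟩
    simp only [(hp _).2]
    exact (continuous_snd.tendsto _).comp hpx

theorem convex_clarkeSubdifferential (x : EuclideanSpace ℝ (Fin d)) :
    Convex ℝ (clarkeSubdifferential f x) := convex_convexHull ℝ _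

theorem norm_gradient_le_of_lipschitzOnWith {K : ℝ≥0} {s : Set (EuclideanSpace ℝ (Fin d))}
    {x : EuclideanSpace ℝ (Fin d)} (hs : s ∈ 𝓝 x) (hK : LipschitzOnWith K f s) :
    ‖gradient f x‖ ≤ K := by
  rw [gradient, LinearIsometryEquiv.norm_map]
  exact norm_fderiv_le_of_lipschitzOn ℝ hs hK

theorem LocallyLipschitz.exists_lipschitzOnWith_closedBall (hf : LocallyLipschitz f) (R : ℝ) :
    ∃ K : ℝ≥0, LipschitzOnWith K f (Metric.closedBall 0 R) :=
  LocallyLipschitzOn.exists_lipschitzOnWith_of_compact (isCompact_closedBall 0 R)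
    hf.locallyLipschitzOn

theorem norm_le_of_mem_gradientGraphClosure {K : ℝ≥0} {R : ℝ}
    (hK : LipschitzOnWith K f (Metric.closedBall 0 R)) {x v : EuclideanSpace ℝ (Fin d)}
    (hx : ‖x‖ < R) (hv : (x, v) ∈ gradientGraphClosure f) : ‖v‖ ≤ K := by
  obtain ⟨p, hp, hpx⟩ := mem_closure_iff_seq_limit.1 hv
  have h1 : Tendsto (fun i => (p i).1) atTop (𝓝 x) := (continuous_fst.tendsto _).comp hpx
  have h2 : Tendsto (fun i => (p i).2) atTop (𝓝 v) := (continuous_snd.tendsto _).comp hpx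
  refine le_of_tendsto h2.norm ?_
  filter_upwards [h1.norm.eventually (gt_mem_nhds hx)] with i hi
  rw [← (hp i).2]
  refine norm_gradient_le_of_lipschitzOnWith (Metric.isOpen_ball.mem_nhds ?_)
    (hK.mono Metric.ball_subset_closedBall)
  simpa using hi

theorem norm_le_of_mem_clarkeSubdifferential {K : ℝ≥0} {R : ℝ}
    (hK : LipschitzOnWith K f (Metric.closedBall 0 R)) {x v : EuclideanSpace ℝ (Fin d)}
    (hx : ‖x‖ < R) (hv : v ∈ clarkeSubdifferential f x) : ‖v‖ ≤ K := by
  rw [clarkeSubdifferential_eq_convexHull] at hv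
  have : convexHull ℝ {v | (x, v) ∈ gradientGraphClosure f} ⊆ Metric.closedBall 0 K :=
    convexHull_min (fun v hv => by
      simpa using norm_le_of_mem_gradientGraphClosure hK hx hv) (convex_closedBall 0 _)
  simpa using this hv

theorem isCompact_clarkeSubdifferential (hf : LocallyLipschitz f)
    (x : EuclideanSpace ℝ (Fin d)) : IsCompact (clarkeSubdifferential f x) := by
  rw [clarkeSubdifferential_eq_convexHull]
  refine isCompact_convexHull_of_finiteDimensional ?_
  obtain ⟨K, hK⟩ := hf.exists_lipschitzOnWith_closedBall (‖x‖ + 1)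
  refine (isCompact_closedBall (0 : EuclideanSpace ℝ (Fin d)) K).of_isClosed_subset ?_ ?_
  · exact isClosed_closure.preimage (by fun_prop : Continuous fun v => (x, v))
  · intro v hv
    simpa using norm_le_of_mem_gradientGraphClosure hK (by simp) hv

/-- Rademacher's theorem on a ball, which has positive measure. -/
theorem LocallyLipschitz.dense_differentiableAt (hf : LocallyLipschitz f) :
    Dense {x | DifferentiableAt ℝ f x} := by
  refine Metric.dense_iff.2 fun x r hr => ?_
  obtain ⟨K, hK⟩ := hf.exists_lipschitzOnWith_closedBall (‖x‖ + r)
  have hsub : Metric.ball x r ⊆ Metric.closedBall 0 (‖x‖ + r) := by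
    intro y hy
    have := norm_le_norm_add_norm_sub' y x
    rw [mem_ball_iff_norm] at hy
    simp only [mem_closedBall_zero_iff]
    linarith
  have hae := (hK.mono hsub).ae_differentiableWithinAt_of_mem (μ := volume)
  have hpos : volume (Metric.ball x r) ≠ 0 := (Metric.measure_ball_pos volume x hr).ne'
  obtain ⟨y, hy, hy'⟩ := (frequently_ae_iff.2 hpos :
    ∃ᶠ y in ae volume, y ∈ Metric.ball x r).and_eventually hae |>.exists
  exact ⟨y, hy, (hy' hy).differentiableAt (Metric.isOpen_ball.mem_nhds hy)⟩

theorem nonempty_clarkeSubdifferential (hf : LocallyLipschitz f)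
    (x : EuclideanSpace ℝ (Fin d)) : (clarkeSubdifferential f x).Nonempty := by
  rw [clarkeSubdifferential_eq_convexHull, convexHull_nonempty_iff]
  obtain ⟨K, hK⟩ := hf.exists_lipschitzOnWith_closedBall (‖x‖ + 1)
  obtain ⟨u, hu, hux⟩ := mem_closure_iff_seq_limit.1 (hf.dense_differentiableAt x)
  have hb : ∃ᶠ i in atTop, gradient f (u i) ∈ Metric.closedBall 0 (K : ℝ) := by
    refine Eventually.frequently ?_
    filter_upwards [hux.norm.eventually (gt_mem_nhds (lt_add_one ‖x‖))] with i hi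
    simpa using norm_le_of_mem_gradientGraphClosure hK hi (subset_closure ⟨hu i, rfl⟩)
  obtain ⟨v, -, φ, hφ, hv⟩ := tendsto_subseq_of_frequently_bounded
    Metric.isBounded_closedBall hb
  exact ⟨v, mem_closure_iff_seq_limit.2 ⟨fun i => (u (φ i), gradient f (u (φ i))),
    fun i => ⟨hu _, rfl⟩, (hux.comp hφ.tendsto_atTop).prodMk_nhds hv⟩⟩

/-- Outer semicontinuity of the Clarke subdifferential. -/
theorem eventually_clarkeSubdifferential_subset_cthickening (hf : LocallyLipschitz f)
    (x : EuclideanSpace ℝ (Fin d)) {ε : ℝ} (hε : 0 < ε) :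
    ∀ᶠ y in 𝓝 x, clarkeSubdifferential f y ⊆
      Metric.cthickening ε (clarkeSubdifferential f x) := by
  obtain ⟨K, hK⟩ := hf.exists_lipschitzOnWith_closedBall (‖x‖ + 1)
  have hne := nonempty_clarkeSubdifferential hf x
  -- The graph points whose gradient is at least `ε` away from `∂f(x)`. Their projection is compact
  -- and misses `x`, hence misses a neighbourhood of `x`.
  set S := (gradientGraphClosure f ∩
    (Metric.closedBall 0 (‖x‖ + 1) ×ˢ Metric.closedBall 0 (K : ℝ))) ∩
      {p | ε ≤ Metric.infDist p.2 (clarkeSubdifferential f x)} with hS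
  have hcS : IsCompact S := by
    refine ((((isCompact_closedBall _ _).prod (isCompact_closedBall _ _)).inter_left
      isClosed_closure)).inter_right ?_
    exact isClosed_le continuous_const ((Metric.continuous_infDist_pt _).comp continuous_snd)
  have hx : x ∉ Prod.fst '' S := by
    rintro ⟨⟨y, v⟩, ⟨⟨h1, -⟩, h3⟩, rfl⟩
    have : v ∈ clarkeSubdifferential f y := by
      rw [clarkeSubdifferential_eq_convexHull]
      exact subset_convexHull ℝ _ h1
    simp only [Set.mem_ofPred_eq, Metric.infDist_zero_of_mem this] at h3
    linarith
  have hev : ∀ᶠ y in 𝓝 x, y ∉ Prod.fst '' S :=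
    (hcS.image continuous_fst).isClosed.isOpen_compl.mem_nhds hx
  filter_upwards [hev, (continuous_norm.tendsto x).eventually (gt_mem_nhds (lt_add_one ‖x‖))]
    with y hy hyn
  rw [clarkeSubdifferential_eq_convexHull f y]
  refine convexHull_min (fun v hv => ?_) ((convex_clarkeSubdifferential x).cthickening ε)
  · by_contra hcon
    refine hy ⟨(y, v), ⟨⟨hv, ?_, ?_⟩, ?_⟩, rfl⟩
    · simpa using hyn.le
    · simpa using norm_le_of_mem_gradientGraphClosure hK hyn hv
    · contrapose! hcon
      exact Metric.thickening_subset_cthickening _ _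
        ((Metric.mem_thickening_iff_infDist_lt hne).2 (not_le.1 hcon))

/-- The element of minimal norm of the Clarke subdifferential, with its variational
characterization. -/
theorem exists_minimal_clarkeSubdifferential (hf : LocallyLipschitz f)
    (x : EuclideanSpace ℝ (Fin d)) :
    ∃ v ∈ clarkeSubdifferential f x, ∀ w ∈ clarkeSubdifferential f x,
      ‖v‖ ^ 2 ≤ inner ℝ v w := by
  obtain ⟨v, hv, hmin⟩ := exists_norm_eq_iInf_of_complete_convex
    (nonempty_clarkeSubdifferential hf x) (isCompact_clarkeSubdifferential hf x).isComplete
    (convex_clarkeSubdifferential x) 0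
  refine ⟨v, hv, fun w hw => ?_⟩
  have := (norm_eq_iInf_iff_real_inner_le_zero (convex_clarkeSubdifferential x) hv).1 hmin w hw
  simp only [zero_sub, inner_neg_left, inner_sub_right, real_inner_self_eq_norm_sq] at this
  linarith

end ClarkeSubdifferential

/-! ### The time scale attached to the step sizes. -/

section StepTime

variable {α : ℕ → ℝ}

/-- The time elapsed before the `n`-th step. -/
noncomputable def stepTime (α : ℕ → ℝ) (n : ℕ) : ℝ := ∑ k ∈ Finset.range n, α k

/-- The index of the step that is under way at time `s`. -/
noncomputable def timeIndex (α : ℕ → ℝ) (s : ℝ) : ℕ := sInf {n | s < stepTime α (n + 1)}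

theorem stepTime_succ (α : ℕ → ℝ) (n : ℕ) : stepTime α (n + 1) = stepTime α n + α n :=
  Finset.sum_range_succ _ _

namespace IsStepSize

theorem monotone_stepTime (hα : IsStepSize α) : Monotone (stepTime α) :=
  monotone_nat_of_le_succ fun n => by
    rw [stepTime_succ]
    linarith [hα.nonneg n]

theorem tendsto_stepTime (hα : IsStepSize α) : Tendsto (stepTime α) atTop atTop :=
  hα.sum_eq_top

theorem tendsto_zero (hα : IsStepSize α) : Tendsto α atTop (𝓝 0) := by
  have h := (Real.continuous_sqrt.tendsto 0).comp hα.sq_summable.tendsto_atTop_zero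
  rw [Real.sqrt_zero] at h
  exact h.congr fun k => Real.sqrt_sq (hα.nonneg k)

theorem lt_stepTime_timeIndex_succ (hα : IsStepSize α) (s : ℝ) :
    s < stepTime α (timeIndex α s + 1) := by
  refine Nat.sInf_mem (s := {n | s < stepTime α (n + 1)}) ?_
  exact ((tendsto_add_atTop_iff_nat 1).2 hα.tendsto_stepTime).eventually_gt_atTop s |>.exists

theorem stepTime_timeIndex_le {s : ℝ} (hs : 0 ≤ s) :
    stepTime α (timeIndex α s) ≤ s := by
  rcases h : timeIndex α s with _ | n
  · simpa [stepTime] using hs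
  · by_contra! hcon
    have : timeIndex α s ≤ n := Nat.sInf_le hcon
    omega

theorem le_timeIndex (hα : IsStepSize α) {s : ℝ} {n : ℕ} (h : stepTime α n ≤ s) :
    n ≤ timeIndex α s := by
  by_contra! hlt
  have := hα.monotone_stepTime (Nat.succ_le_of_lt hlt)
  linarith [hα.lt_stepTime_timeIndex_succ s]

theorem timeIndex_lt (hα : IsStepSize α) {s : ℝ} (hs : 0 ≤ s) {n : ℕ} (h : s < stepTime α n) :
    timeIndex α s < n := by
  by_contra! hlt
  linarith [hα.monotone_stepTime hlt, stepTime_timeIndex_le (α := α) hs]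

theorem monotone_timeIndex (hα : IsStepSize α) : Monotone (timeIndex α) := fun _ t hst =>
  Nat.sInf_le (hst.trans_lt (hα.lt_stepTime_timeIndex_succ t))

theorem tendsto_timeIndex (hα : IsStepSize α) : Tendsto (timeIndex α) atTop atTop :=
  tendsto_atTop.2 fun n => (eventually_ge_atTop (stepTime α n)).mono fun _ h => hα.le_timeIndex h

/-- The rounding error is at most the length of the current step, which tends to `0`. -/
theorem tendsto_stepTime_timeIndex_sub (hα : IsStepSize α) :
    Tendsto (fun s => stepTime α (timeIndex α s) - s) atTop (𝓝 0) := by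
  refine squeeze_zero_norm' ?_ (hα.tendsto_zero.comp hα.tendsto_timeIndex)
  filter_upwards [eventually_ge_atTop 0] with s hs
  have h1 := stepTime_timeIndex_le (α := α) hs
  have h2 := hα.lt_stepTime_timeIndex_succ s
  rw [stepTime_succ] at h2
  rw [Real.norm_eq_abs, Function.comp_apply, abs_le]
  constructor <;> linarith [hα.nonneg (timeIndex α s)]

theorem tendsto_stepTime_add {l : Filter ℕ} (hα : IsStepSize α) (hl : l ≤ atTop) (t : ℝ) :
    Tendsto (fun k => stepTime α k + t) l atTop :=
  tendsto_atTop_add_const_right _ _ (hα.tendsto_stepTime.mono_left hl)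

/-- The steps under way at the times `t` and `s` after step `k` are separated by a duration which
tends to `s - t`. -/
theorem tendsto_stepTime_timeIndex_sub_stepTime_timeIndex {l : Filter ℕ} (hα : IsStepSize α)
    (hl : l ≤ atTop) (s t : ℝ) :
    Tendsto (fun k => stepTime α (timeIndex α (stepTime α k + s)) -
      stepTime α (timeIndex α (stepTime α k + t))) l (𝓝 (s - t)) := by
  have hs := hα.tendsto_stepTime_timeIndex_sub.comp (hα.tendsto_stepTime_add hl s)
  have ht := hα.tendsto_stepTime_timeIndex_sub.comp (hα.tendsto_stepTime_add hl t)
  have := (hs.sub ht).add_const (s - t)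
  simp only [sub_zero, zero_add] at this
  refine this.congr fun k => ?_
  simp only [Function.comp_apply]
  ring

end IsStepSize

end StepTime

/-! ### Limit curves of the noiseless iteration and descent of `f` along them. -/

section LimitCurve

variable {d : ℕ} {f : EuclideanSpace ℝ (Fin d) → ℝ} {α : ℕ → ℝ}
  {w y : ℕ → EuclideanSpace ℝ (Fin d)} {M : ℝ≥0}

theorem norm_sub_le_mul_stepTime_sub (hα : IsStepSize α) (hw : ∀ k, w (k + 1) = w k + α k • y k)
    (hy : ∀ k, ‖y k‖ ≤ M) {m n : ℕ} (hmn : m ≤ n) :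
    ‖w n - w m‖ ≤ M * (stepTime α n - stepTime α m) := by
  induction n, hmn using Nat.le_induction with
  | base => simp
  | succ n hmn ih =>
    have h1 : ‖α n • y n‖ ≤ α n * M := by
      rw [norm_smul, Real.norm_of_nonneg (hα.nonneg n)]
      exact mul_le_mul_of_nonneg_left (hy n) (hα.nonneg n)
    rw [hw, stepTime_succ, add_sub_right_comm]
    linarith [norm_add_le (w n - w m) (α n • y n)]

theorem tendsto_dist_timeIndex_stepTime {l : Filter ℕ} (hα : IsStepSize α)
    (hw : ∀ k, w (k + 1) = w k + α k • y k) (hy : ∀ k, ‖y k‖ ≤ M) (hl : l ≤ atTop) :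
    Tendsto (fun k => dist (w (timeIndex α (stepTime α k + 0))) (w k)) l (𝓝 0) := by
  have hdist := (hα.tendsto_stepTime_timeIndex_sub.comp
    (hα.tendsto_stepTime_add hl 0)).const_mul (M : ℝ)
  rw [mul_zero] at hdist
  refine squeeze_zero (fun _ => dist_nonneg) (fun k => ?_) hdist
  rw [dist_eq_norm, Function.comp_apply, add_zero]
  exact norm_sub_le_mul_stepTime_sub hα hw hy (hα.le_timeIndex le_rfl)

theorem inner_sub_le_mul_stepTime_sub (hα : IsStepSize α)
    (hw : ∀ k, w (k + 1) = w k + α k • y k) {v : EuclideanSpace ℝ (Fin d)} {c : ℝ} {m n : ℕ}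
    (hmn : m ≤ n) (hc : ∀ i, m ≤ i → i < n → inner ℝ v (y i) ≤ c) :
    inner ℝ v (w n - w m) ≤ c * (stepTime α n - stepTime α m) := by
  induction n, hmn using Nat.le_induction with
  | base => simp
  | succ n hmn ih =>
    have h1 := mul_le_mul_of_nonneg_left (hc n hmn n.lt_succ_self) (hα.nonneg n)
    have h2 := ih fun i hi hin => hc i hi (hin.trans n.lt_succ_self)
    rw [hw, stepTime_succ, add_sub_right_comm, inner_add_right, inner_smul_right]
    linarith

/-- Along the sequence `w` with increments `α • y`, the directions `y` are asymptotically descent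
directions for the minimal-norm Clarke subgradients of `f`. -/
def IsAsymptoticDescent (f : EuclideanSpace ℝ (Fin d) → ℝ)
    (w y : ℕ → EuclideanSpace ℝ (Fin d)) : Prop :=
  ∀ x, ∃ v ∈ clarkeSubdifferential f x, ∀ ε > 0, ∃ δ > 0, ∃ N, ∀ i ≥ N, dist (w i) x < δ →
    inner ℝ v (y i) ≤ -‖v‖ ^ 2 + ε

/-- Any ultrafilter limit of the time-shifted interpolations of `w` is a Lipschitz curve along
which `f` decreases, in the sense of left Dini derivatives. -/
theorem IsAsymptoticDescent.exists_limit_curve (hD : IsAsymptoticDescent f w y)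
    (hreg : ∀ x, SubdifferentiallyRegularAt f x) (hα : IsStepSize α)
    (hw : ∀ k, w (k + 1) = w k + α k • y k) (hy : ∀ k, ‖y k‖ ≤ M) (hM : 0 < M)
    {C : ℝ} (hwC : ∀ k, ‖w k‖ ≤ C) (U : Ultrafilter ℕ) (hU : (U : Filter ℕ) ≤ atTop) :
    ∃ z : ℝ → EuclideanSpace ℝ (Fin d), LipschitzWith M z ∧
      (∀ t, Tendsto (fun k => w (timeIndex α (stepTime α k + t))) U (𝓝 (z t))) ∧
      ∀ t, ∃ c ≥ 0, (c = 0 → IsClarkeCritical f (z t)) ∧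
        ∀ ε > 0, ∀ᶠ h in 𝓝[>] 0, f (z t) ≤ f (z (t - h)) - h * (c - ε) := by
  -- An ultrafilter converges at all times `t` at once, so no diagonal extraction is needed.
  -- Negative `t` is allowed because `stepTime α k + t` tends to infinity along `U`.
  have hex : ∀ t, ∃ a, Tendsto (fun k => w (timeIndex α (stepTime α k + t))) U (𝓝 a) := by
    intro t
    have hmem : Metric.closedBall (0 : EuclideanSpace ℝ (Fin d)) C ∈
        U.map fun k => w (timeIndex α (stepTime α k + t)) := by
      refine Ultrafilter.mem_map.2 (univ_mem' fun k => ?_)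
      rw [Set.mem_preimage, mem_closedBall_zero_iff]
      exact hwC _
    obtain ⟨a, -, ha⟩ := (isCompact_closedBall _ C).ultrafilter_le_nhds' _ hmem
    exact ⟨a, ha⟩
  choose z hz using hex
  have hidx : ∀ {s t : ℝ} (k : ℕ), t ≤ s →
      timeIndex α (stepTime α k + t) ≤ timeIndex α (stepTime α k + s) := fun k hts =>
    hα.monotone_timeIndex (by linarith)
  have hdur := hα.tendsto_stepTime_timeIndex_sub_stepTime_timeIndex hU
  have hzle : ∀ t s, t ≤ s → ‖z s - z t‖ ≤ M * (s - t) := by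
    intro t s hts
    exact le_of_tendsto_of_tendsto ((hz s).sub (hz t)).norm ((hdur s t).const_mul _)
      (Eventually.of_forall fun k => norm_sub_le_mul_stepTime_sub hα hw hy (hidx k hts))
  refine ⟨z, ?_, hz, fun t => ?_⟩
  · refine LipschitzWith.of_dist_le_mul fun s t => ?_
    rcases le_total t s with h | h
    · rw [dist_eq_norm, Real.dist_eq, abs_of_nonneg (sub_nonneg.2 h)]
      exact hzle t s h
    · rw [dist_comm, dist_comm s, dist_eq_norm, Real.dist_eq, abs_of_nonneg (sub_nonneg.2 h)]
      exact hzle s t h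
  obtain ⟨v, hv, hdesc⟩ := hD (z t)
  refine ⟨‖v‖ ^ 2, sq_nonneg _, fun h0 => ?_, fun ε hε => ?_⟩
  · have : v = 0 := by simpa using h0
    rwa [this] at hv
  obtain ⟨δ, hδ, N, hN⟩ := hdesc (ε / 2) (by positivity)
  have hM' : (0 : ℝ) < M := hM
  -- All iterates between times `t - h` and `t` lie within `δ` of `z t`: one half comes from the
  -- speed bound `M`, the other from convergence at time `t`. The descent inequality thus holds at
  -- each of these steps and can be summed.
  have hinner : ∀ h, 0 < h → M * h < δ / 2 →
      inner ℝ v (z t - z (t - h)) ≤ (-‖v‖ ^ 2 + ε / 2) * h := by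
    intro h hh hhδ
    have hlim := (hdur t (t - h)).const_mul (-‖v‖ ^ 2 + ε / 2)
    rw [sub_sub_cancel] at hlim
    refine le_of_tendsto_of_tendsto
      (Tendsto.inner (𝕜 := ℝ) (tendsto_const_nhds (x := v)) ((hz t).sub (hz (t - h)))) hlim ?_
    have hdur' := (hdur t (t - h)).const_mul (M : ℝ)
    rw [sub_sub_cancel] at hdur'
    filter_upwards [hdur'.eventually (gt_mem_nhds hhδ),
      (hz t).eventually (Metric.ball_mem_nhds _ (half_pos hδ)),
      (hα.tendsto_timeIndex.comp (hα.tendsto_stepTime_add hU (t - h))).eventually_ge_atTop N]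
      with k hk1 hk2 hk3
    refine inner_sub_le_mul_stepTime_sub hα hw (hidx k (by linarith)) fun i hi1 hi2 => ?_
    refine hN i (hk3.trans hi1) ?_
    have h1 := norm_sub_le_mul_stepTime_sub hα hw hy hi2.le
    have h2 := mul_le_mul_of_nonneg_left (hα.monotone_stepTime hi1) hM'.le
    rw [← dist_eq_norm, dist_comm] at h1
    have h3 := dist_triangle (w i) (w (timeIndex α (stepTime α k + t))) (z t)
    linarith
  obtain ⟨r, hr, hfr⟩ := hreg (z t) v hv
  have hzt : Tendsto (fun h => z (t - h)) (𝓝[>] 0) (𝓝 (z t)) := by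
    rw [tendsto_iff_norm_sub_tendsto_zero]
    have h0 : Tendsto (fun h : ℝ => (M : ℝ) * h) (𝓝[>] 0) (𝓝 0) := by
      have : Tendsto (fun h : ℝ => (M : ℝ) * h) (𝓝 0) (𝓝 ((M : ℝ) * 0)) :=
        (continuous_const_mul (M : ℝ)).tendsto 0
      rw [mul_zero] at this
      exact this.mono_left nhdsWithin_le_nhds
    refine squeeze_zero' (Eventually.of_forall fun _ => norm_nonneg _) ?_ h0
    filter_upwards [self_mem_nhdsWithin] with h hh
    rw [norm_sub_rev]
    simpa using hzle (t - h) t (by linarith [Set.mem_Ioi.1 hh])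
  have hsmall : ∀ᶠ h : ℝ in 𝓝[>] 0, M * h < δ / 2 := by
    filter_upwards [Ioo_mem_nhdsGT (show (0 : ℝ) < δ / 2 / M by positivity)] with h hh
    rw [mul_comm]
    exact (lt_div_iff₀ hM').1 hh.2
  filter_upwards [self_mem_nhdsWithin, hsmall, hzt.eventually hfr,
    hzt.eventually (hr.def (show 0 < ε / 2 / M by positivity))] with h hh h1 h2 h3
  have h4 := hinner h hh h1
  have h5 := hzle (t - h) t (by linarith [Set.mem_Ioi.1 hh])
  rw [sub_sub_cancel] at h5
  have h6 : ‖r (z (t - h))‖ ≤ ε / 2 * h := by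
    refine h3.trans ?_
    rw [norm_sub_rev]
    calc ε / 2 / M * ‖z t - z (t - h)‖ ≤ ε / 2 / M * (M * h) := by gcongr
      _ = ε / 2 * h := by field_simp
  have h7 := neg_le_of_abs_le h6
  rw [← neg_sub, inner_neg_right] at h2
  nlinarith

/-- A continuous function is nonincreasing if its left upper Dini derivatives are nonpositive. -/
theorem antitone_of_left_dini_nonpos {g : ℝ → ℝ} (hg : Continuous g)
    (h : ∀ t, ∀ ε > 0, ∀ᶠ s in 𝓝[>] (0 : ℝ), g t ≤ g (t - s) + s * ε) : Antitone g := by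
  intro a b hab
  -- The reflection `s ↦ -g (-s)` turns left Dini derivatives into right ones.
  have := image_le_of_liminf_slope_right_le_deriv_boundary (f := fun s => -g (-s))
    (a := -b) (b := -a) (by fun_prop) (B := fun _ => -g b) (B' := fun _ => 0) (by simp)
    continuousOn_const (fun x _ => hasDerivWithinAt_const _ _ _) ?_
    (x := -a) ⟨by linarith, le_rfl⟩
  · simpa using this
  · intro x _ r hr
    refine Eventually.frequently ?_
    have hmap : Tendsto (fun u => u - x) (𝓝[>] x) (𝓝[>] 0) := by
      refine tendsto_nhdsWithin_iff.2 ⟨?_, ?_⟩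
      · have : Tendsto (fun u => u - x) (𝓝 x) (𝓝 (x - x)) := (continuous_sub_right x).tendsto x
        rw [sub_self] at this
        exact this.mono_left nhdsWithin_le_nhds
      · filter_upwards [self_mem_nhdsWithin] with u hu
        exact sub_pos.2 (Set.mem_Ioi.1 hu)
    filter_upwards [hmap.eventually (h (-x) (r / 2) (by positivity)), self_mem_nhdsWithin]
      with u hu hxu
    have hxu' : 0 < u - x := sub_pos.2 (Set.mem_Ioi.1 hxu)
    rw [slope_def_field, div_lt_iff₀ hxu']
    rw [show -x - (u - x) = -u by ring] at hu
    nlinarith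

/-- Density of the noncritical values is used only to choose the lower level of a hypothetical
upcrossing; criticality of limit points then follows from convergence of the values. -/
theorem IsAsymptoticDescent.exists_tendsto_and_isClarkeCritical (hD : IsAsymptoticDescent f w y)
    (hf : LocallyLipschitz f) (hreg : ∀ x, SubdifferentiallyRegularAt f x)
    (hsard : Dense (criticalValues f)ᶜ) (hα : IsStepSize α)
    (hw : ∀ k, w (k + 1) = w k + α k • y k) {M C : ℝ} (hy : ∀ k, ‖y k‖ ≤ M)
    (hwC : ∀ k, ‖w k‖ ≤ C) :
    (∀ x, MapClusterPt x atTop w → IsClarkeCritical f x) ∧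
      ∃ L : ℝ, Tendsto (fun k => f (w k)) atTop (𝓝 L) := by
  obtain ⟨K, hK0, hyK⟩ : ∃ K : ℝ≥0, 0 < K ∧ ∀ k, ‖y k‖ ≤ K := by
    refine ⟨M.toNNReal + 1, by positivity, fun k => (hy k).trans ?_⟩
    push_cast
    linarith [Real.le_coe_toNNReal M]
  have hfc : Continuous f := hf.continuous
  obtain ⟨J, hJ⟩ := hf.exists_lipschitzOnWith_closedBall C
  have hwmem : ∀ k, w k ∈ Metric.closedBall (0 : EuclideanSpace ℝ (Fin d)) C := fun k => by
    simpa using hwC k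
  have hcurve := fun U hU => hD.exists_limit_curve hreg hα hw hyK hK0 hwC U hU
  -- a curve on which `f` is locally constant consists of critical points
  have hcrit : ∀ {z : ℝ → EuclideanSpace ℝ (Fin d)} {t : ℝ},
      (∃ c ≥ 0, (c = 0 → IsClarkeCritical f (z t)) ∧
        ∀ ε > 0, ∀ᶠ h in 𝓝[>] 0, f (z t) ≤ f (z (t - h)) - h * (c - ε)) →
      (∀ᶠ h in 𝓝[>] 0, f (z (t - h)) = f (z t)) → IsClarkeCritical f (z t) := by
    rintro z t ⟨c, hc, hc0, hdini⟩ hconst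
    refine hc0 (le_antisymm ?_ hc)
    by_contra! hpos
    obtain ⟨h, ⟨h1, h2⟩, h3⟩ := ((hdini (c / 2) (by positivity)).and hconst |>.and
      self_mem_nhdsWithin).exists
    rw [h2] at h1
    have : 0 < h * (c - c / 2) := mul_pos h3 (by linarith)
    linarith
  have hconv : ∃ L : ℝ, Tendsto (fun k => f (w k)) atTop (𝓝 L) := by
    have hbdd : Bornology.IsBounded (Set.range fun k => f (w k)) := by
      refine ((isCompact_closedBall (0 : EuclideanSpace ℝ (Fin d)) C).image hfc).isBounded.subset ?_
      rintro _ ⟨k, rfl⟩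
      exact ⟨w k, hwmem k, rfl⟩
    refine tendsto_of_no_upcrossings hsard ?_ hbdd.bddAbove.isBoundedUnder_of_range
      hbdd.bddBelow.isBoundedUnder_of_range
    rintro a ha b - hab ⟨hfa, hfb⟩
    -- `P i`: `i` is the last index at or below level `a` before `f ∘ w` exceeds `b`.
    set P : ℕ → Prop := fun i => f (w i) ≤ a ∧ ∃ j ≥ i, b < f (w j) ∧
      ∀ l, i < l → l ≤ j → a < f (w l) with hP
    have hPfreq : ∃ᶠ i in atTop, P i := by
      refine frequently_atTop.2 fun n => ?_
      obtain ⟨i₀, hi₀, hi₀a⟩ := frequently_atTop.1 hfa n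
      obtain ⟨j, hj, hjb⟩ := frequently_atTop.1 hfb i₀
      classical
      refine ⟨Nat.findGreatest (fun l => f (w l) ≤ a) j,
        hi₀.trans (Nat.le_findGreatest hj hi₀a.le),
        Nat.findGreatest_spec (P := fun l => f (w l) ≤ a) hj hi₀a.le, j, Nat.findGreatest_le j,
        hjb, fun l hl hlj => not_le.1 (Nat.findGreatest_is_greatest hl hlj)⟩
    have : NeBot (atTop ⊓ 𝓟 {i | P i}) := frequently_iff_neBot.1 hPfreq
    set U := Ultrafilter.of (atTop ⊓ 𝓟 {i | P i})
    have hUle : (U : Filter ℕ) ≤ atTop ⊓ 𝓟 {i | P i} := Ultrafilter.of_le _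
    have hU : (U : Filter ℕ) ≤ atTop := hUle.trans inf_le_left
    have hUP : ∀ᶠ i in (U : Filter ℕ), P i := le_principal_iff.1 (hUle.trans inf_le_right)
    obtain ⟨z, hzlip, hz, hzd⟩ := hcurve U hU
    have hanti : Antitone fun t => f (z t) := by
      refine antitone_of_left_dini_nonpos (hfc.comp hzlip.continuous) fun t ε hε => ?_
      obtain ⟨c, hc, -, hdini⟩ := hzd t
      filter_upwards [hdini ε hε, self_mem_nhdsWithin] with h hh hpos
      nlinarith [mul_nonneg (le_of_lt hpos) hc]
    have h0 : f (z 0) ≤ a := by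
      have hlim : Tendsto (fun k => w k) U (𝓝 (z 0)) :=
        tendsto_of_tendsto_of_dist (hz 0)
          (tendsto_dist_timeIndex_stepTime hα hw hyK hU)
      exact le_of_tendsto ((hfc.tendsto _).comp hlim) (hUP.mono fun i hi => hi.1)
    -- Since `f ∘ w` changes at speed at most `J * K`, climbing from `a` to `b` takes a time bounded
    -- below independently of `i`. The `+ 1` keeps the denominator positive.
    obtain ⟨T, hT, hTP⟩ : ∃ T > 0, ∀ i, P i → ∃ j, stepTime α i + T ≤ stepTime α j ∧
        ∀ l, i < l → l ≤ j → a < f (w l) := by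
      refine ⟨(b - a) / ((J + 1) * K), by
        have : (0 : ℝ) < K := hK0
        have := sub_pos.2 hab
        positivity, fun i hi => ?_⟩
      obtain ⟨hia, j, hij, hjb, hl⟩ := hi
      refine ⟨j, ?_, hl⟩
      have h1 := hJ.dist_le_mul _ (hwmem j) _ (hwmem i)
      have h2 := norm_sub_le_mul_stepTime_sub hα hw hyK hij
      rw [← dist_eq_norm] at h2
      have h3 := (le_abs_self _).trans_eq (Real.dist_eq (f (w j)) (f (w i))).symm
      have h4 : (b - a) ≤ (stepTime α j - stepTime α i) * ((J + 1) * K) := by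
        have hJ0 : (0 : ℝ) ≤ J := J.2
        have := mul_le_mul_of_nonneg_left h2 (show (0 : ℝ) ≤ J + 1 by positivity)
        have h5 : (0 : ℝ) ≤ dist (w j) (w i) := dist_nonneg
        nlinarith
      have hpos : (0 : ℝ) < (J + 1) * K := mul_pos (by positivity) hK0
      linarith [(div_le_iff₀ hpos).2 h4]
    have hge : ∀ t, 0 < t → t < T → a ≤ f (z t) := by
      intro t ht htT
      refine ge_of_tendsto ((hfc.tendsto _).comp (hz t)) ?_
      -- Once `α i < t`, the index at time `t` after step `i` is at least `i + 1`, hence strictly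
      -- inside the excursion above `a`.
      filter_upwards [hUP, hU (hα.tendsto_zero.eventually (gt_mem_nhds ht))] with i hi hαi
      obtain ⟨j, hj, hl⟩ := hTP i hi
      have hi0 : 0 ≤ stepTime α i := Finset.sum_nonneg fun k _ => hα.nonneg k
      refine (hl _ (Nat.lt_of_succ_le (hα.le_timeIndex ?_))
        (hα.timeIndex_lt (by linarith) (by linarith)).le).le
      have hαi' : α i < t := hαi
      rw [Nat.succ_eq_add_one, stepTime_succ]
      linarith
    have heq : ∀ t, 0 < t → t < T → f (z t) = a := fun t ht htT =>
      le_antisymm ((hanti ht.le).trans h0) (hge t ht htT)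
    refine ha ⟨z (T / 2), hcrit (hzd _) ?_, heq _ (by linarith) (by linarith)⟩
    filter_upwards [Ioo_mem_nhdsGT (half_pos hT)] with h hh
    rw [heq _ (by linarith [hh.2]) (by linarith [hh.1]), heq _ (by linarith) (by linarith)]
  refine ⟨fun x hx => ?_, hconv⟩
  obtain ⟨L, hL⟩ := hconv
  obtain ⟨U, hU, hUx⟩ := mapClusterPt_iff_ultrafilter.1 hx
  obtain ⟨z, -, hz, hzd⟩ := hcurve U hU
  have hfz : ∀ t, f (z t) = L := fun t =>
    tendsto_nhds_unique ((hfc.tendsto _).comp (hz t))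
      (hL.comp (hα.tendsto_timeIndex.comp (hα.tendsto_stepTime_add hU t)))
  have hx0 : z 0 = x := by
    refine tendsto_nhds_unique (hz 0) ?_
    refine tendsto_of_tendsto_of_dist hUx ?_
    simpa only [dist_comm] using tendsto_dist_timeIndex_stepTime hα hw hyK hU
  rw [← hx0]
  exact hcrit (hzd 0) (Eventually.of_forall fun h => by rw [hfz, hfz])

end LimitCurve

/-! ### From the averaging hypothesis to descent, and removal of the noise. -/

section StochasticApproximation

variable {d : ℕ} {f : EuclideanSpace ℝ (Fin d) → ℝ} {α : ℕ → ℝ}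
  {x y ξ : ℕ → EuclideanSpace ℝ (Fin d)}

namespace IsStochasticApproximation

/-- If descent failed, infinitely many `y i` with `w i` approaching `a` would lie in a half-space at
positive distance from `-∂f(a)`. Their averages stay in that half-space, contradicting `average`. -/
theorem isAsymptoticDescent (hf : LocallyLipschitz f)
    (h : IsStochasticApproximation (fun z => -clarkeSubdifferential f z) α x y ξ)
    {w : ℕ → EuclideanSpace ℝ (Fin d)} (hwx : Tendsto (fun k => dist (w k) (x k)) atTop (𝓝 0)) :
    IsAsymptoticDescent f w y := by
  intro a
  obtain ⟨v, hv, hmin⟩ := exists_minimal_clarkeSubdifferential hf a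
  refine ⟨v, hv, fun ε hε => ?_⟩
  by_contra! hcon
  obtain ⟨κ, hκ, hP⟩ := extraction_forall_of_frequently
    (P := fun n i => dist (w i) a < 1 / ((n : ℝ) + 1) ∧ -‖v‖ ^ 2 + ε < inner ℝ v (y i))
    fun n => frequently_atTop.2 fun N => by
      obtain ⟨i, hi, h1, h2⟩ := hcon (1 / ((n : ℝ) + 1)) (by positivity) N
      exact ⟨i, hi, h1, h2⟩
  have hwa : Tendsto (fun j => w (κ j)) atTop (𝓝 a) :=
    tendsto_iff_dist_tendsto_zero.2 (squeeze_zero (fun _ => dist_nonneg) (fun j => (hP j).1.le)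
      tendsto_one_div_add_atTop_nhds_zero_nat)
  have hxa : Tendsto (fun j => x (κ j)) atTop (𝓝 a) :=
    tendsto_of_tendsto_of_dist hwa (hwx.comp hκ.tendsto_atTop)
  have hlim := h.average κ a hκ hxa
  -- A lower bound for the distance from the half-space to `-∂f(a)`; the `+ 1` covers `v = 0`.
  have hpos : 0 < ε / (‖v‖ + 1) := by positivity
  refine hpos.not_ge (ge_of_tendsto hlim ?_)
  filter_upwards [eventually_ge_atTop 1] with n hn
  refine (Metric.le_infDist ((nonempty_clarkeSubdifferential hf a).neg)).2 fun {u} hu => ?_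
  have hn' : (0 : ℝ) < n := by exact_mod_cast hn
  have h1 : -‖v‖ ^ 2 + ε ≤ inner ℝ v ((n : ℝ)⁻¹ • ∑ j ∈ Finset.range n, y (κ j)) := by
    rw [inner_smul_right, inner_sum, inv_mul_eq_div, le_div_iff₀ hn']
    calc (-‖v‖ ^ 2 + ε) * n = ∑ j ∈ Finset.range n, (-‖v‖ ^ 2 + ε) := by
          rw [Finset.sum_const, Finset.card_range, nsmul_eq_mul, mul_comm]
      _ ≤ _ := Finset.sum_le_sum fun j _ => (hP j).2.le
  have h2 := hmin (-u) (Set.mem_neg.1 hu)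
  rw [inner_neg_right] at h2
  have h3 := real_inner_le_norm v ((n : ℝ)⁻¹ • ∑ j ∈ Finset.range n, y (κ j) - u)
  rw [inner_sub_right, ← dist_eq_norm] at h3
  rw [div_le_iff₀ (by positivity)]
  have h4 : 0 ≤ dist ((n : ℝ)⁻¹ • ∑ j ∈ Finset.range n, y (κ j)) u := dist_nonneg
  linarith

theorem isClarkeCritical_and_exists_tendsto (hf : LocallyLipschitz f)
    (hreg : ∀ x, SubdifferentiallyRegularAt f x) (hsard : Dense (criticalValues f)ᶜ)
    (h : IsStochasticApproximation (fun z => -clarkeSubdifferential f z) α x y ξ) :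
    (∀ z, MapClusterPt z atTop x → IsClarkeCritical f z) ∧
      ∃ L : ℝ, Tendsto (fun k => f (x k)) atTop (𝓝 L) := by
  obtain ⟨v, hv⟩ := h.noise
  obtain ⟨C, hC⟩ := h.bounded_x
  obtain ⟨M, hM⟩ := h.bounded_y
  -- removing the noise
  set w : ℕ → EuclideanSpace ℝ (Fin d) :=
    fun k => x k + (v - ∑ i ∈ Finset.range k, α i • ξ i) with hw
  have hstep : ∀ k, w (k + 1) = w k + α k • y k := fun k => by
    simp only [hw, h.step, Finset.sum_range_succ, smul_add]
    abel
  have hdist : Tendsto (fun k => dist (w k) (x k)) atTop (𝓝 0) := by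
    have := (hv.const_sub v).norm
    simpa [hw, dist_eq_norm] using this
  obtain ⟨D, hD⟩ := hdist.bddAbove_range
  have hxC : ∀ k, x k ∈ Metric.closedBall 0 (C + D) := fun k => by
    have := hD ⟨k, rfl⟩
    rw [mem_closedBall_zero_iff]
    linarith [hC k, (dist_nonneg : 0 ≤ dist (w k) (x k))]
  have hwC : ∀ k, w k ∈ Metric.closedBall 0 (C + D) := fun k => by
    have h1 := hD ⟨k, rfl⟩
    have h2 := hC k
    rw [← dist_zero_right] at h2
    exact (dist_triangle _ _ _).trans (by linarith)
  obtain ⟨hcrit, L, hL⟩ := (h.isAsymptoticDescent hf hdist).exists_tendsto_and_isClarkeCritical hf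
    hreg hsard h.stepSize hstep hM fun k => mem_closedBall_zero_iff.1 (hwC k)
  refine ⟨fun z hz => ?_, L, ?_⟩
  · obtain ⟨U, hU, hUz⟩ := mapClusterPt_iff_ultrafilter.1 hz
    refine hcrit z (mapClusterPt_iff_ultrafilter.2 ⟨U, hU, ?_⟩)
    refine tendsto_of_tendsto_of_dist hUz ?_
    simpa only [dist_comm] using hdist.mono_left hU
  · obtain ⟨J, hJ⟩ := hf.exists_lipschitzOnWith_closedBall (C + D)
    refine tendsto_of_tendsto_of_dist hL ?_
    have h0 := hdist.const_mul (J : ℝ)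
    rw [mul_zero] at h0
    exact squeeze_zero (fun _ => dist_nonneg) (fun k => hJ.dist_le_mul _ (hwC k) _ (hxC k)) h0

end IsStochasticApproximation

/-- Averages of Clarke subgradients at points converging to `a` approach the Clarke subdifferential
at `a`. -/
theorem tendsto_infDist_average_clarkeSubdifferential (hf : LocallyLipschitz f)
    {a : EuclideanSpace ℝ (Fin d)} (hx : Tendsto x atTop (𝓝 a))
    (hy : ∀ k, y k ∈ clarkeSubdifferential f (x k)) :
    Tendsto (fun n : ℕ => Metric.infDist ((n : ℝ)⁻¹ • ∑ j ∈ Finset.range n, y j)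
      (clarkeSubdifferential f a)) atTop (𝓝 0) := by
  have hne := nonempty_clarkeSubdifferential hf a
  have hp := fun j => (isCompact_clarkeSubdifferential hf a).exists_infDist_eq_dist hne (y j)
  choose p hpmem hp using hp
  -- `p j` is a nearest point to `y j` in `∂f(a)`. Averages of `p` remain there by convexity, and
  -- the averaged error vanishes by Cesàro.
  have hyp : Tendsto (fun j => y j - p j) atTop (𝓝 0) := by
    rw [tendsto_zero_iff_norm_tendsto_zero]
    refine tendsto_order.2 ⟨fun b hb => Eventually.of_forall fun j => hb.trans_le (norm_nonneg _),
      fun ε hε => ?_⟩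
    filter_upwards [hx.eventually
      (eventually_clarkeSubdifferential_subset_cthickening hf a (half_pos hε))] with j hj
    rw [← dist_eq_norm, ← hp j]
    have h1 := hj (hy j)
    rw [(isCompact_clarkeSubdifferential hf a).cthickening_eq_biUnion_closedBall
      (half_pos hε).le] at h1
    obtain ⟨q, hq, hyq⟩ := Set.mem_iUnion₂.1 h1
    exact ((Metric.infDist_le_dist_of_mem hq).trans hyq).trans_lt (half_lt_self hε)
  refine squeeze_zero' (Eventually.of_forall fun _ => Metric.infDist_nonneg) ?_
    (by simpa using hyp.cesaro_smul.norm)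
  filter_upwards [eventually_ge_atTop 1] with n hn
  have hn' : (n : ℝ) ≠ 0 := by positivity
  have hmem : (n : ℝ)⁻¹ • ∑ j ∈ Finset.range n, p j ∈ clarkeSubdifferential f a := by
    rw [Finset.smul_sum]
    refine (convex_clarkeSubdifferential a).sum_mem (fun _ _ => by positivity) ?_
      fun j _ => hpmem j
    simp [hn']
  refine (Metric.infDist_le_dist_of_mem hmem).trans_eq ?_
  rw [dist_eq_norm, ← smul_sub, ← Finset.sum_sub_distrib]

end StochasticApproximation

/-! ### Almost sure convergence of square-summable martingale difference series. -/

section MartingaleDifference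

variable {Ω : Type*} {m : MeasurableSpace Ω} {μ : Measure Ω}

/-- A series of real martingale differences with summable second moments converges almost
surely. -/
theorem ae_exists_tendsto_sum_of_martingale_difference [IsFiniteMeasure μ] {ℱ : Filtration ℕ m}
    {η : ℕ → Ω → ℝ} {c : ℕ → ℝ≥0} (hη : ∀ k, StronglyMeasurable[ℱ (k + 1)] (η k))
    (hc : ∀ k, ∫⁻ ω, ‖η k ω‖ₑ ^ 2 ∂μ ≤ c k) (hcsum : Summable c)
    (hmean : ∀ k, μ[η k | ℱ k] =ᵐ[μ] 0) :
    ∀ᵐ ω ∂μ, ∃ l, Tendsto (fun n => ∑ k ∈ Finset.range n, η k ω) atTop (𝓝 l) := by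
  have hL2 : ∀ k, MemLp (η k) 2 μ := fun k => by
    refine ⟨((hη k).mono (ℱ.le _)).aestronglyMeasurable, ?_⟩
    rw [eLpNorm_lt_top_iff_lintegral_rpow_enorm_lt_top two_ne_zero ENNReal.ofNat_ne_top]
    refine lt_of_le_of_lt ?_ (ENNReal.coe_lt_top (r := c k))
    simpa using hc k
  have hsq : ∀ k, ∫ ω, η k ω ^ 2 ∂μ ≤ c k := fun k => by
    rw [integral_eq_lintegral_of_nonneg_ae (Eventually.of_forall fun ω => sq_nonneg _)
      (hL2 k).integrable_sq.aestronglyMeasurable]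
    refine ENNReal.toReal_le_coe_of_le_coe ((lintegral_mono fun ω => ?_).trans (hc k))
    rw [← sq_abs, ENNReal.ofReal_pow (abs_nonneg _), ← Real.enorm_eq_ofReal_abs]
  set S : ℕ → Ω → ℝ := fun n ω => ∑ k ∈ Finset.range n, η k ω with hS
  have hSsucc : ∀ n, S (n + 1) = S n + η n := fun n => by
    ext ω
    simp [hS, Finset.sum_range_succ]
  have hSmeas : ∀ n, StronglyMeasurable[ℱ n] (S n) := fun n =>
    Finset.stronglyMeasurable_fun_sum _ fun k hk =>
      (hη k).mono (ℱ.mono (Finset.mem_range.1 hk))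
  have hSL2 : ∀ n, MemLp (S n) 2 μ := fun n => memLp_finsetSum _ fun k _ => hL2 k
  have hSint : ∀ n, Integrable (S n) μ := fun n => (hSL2 n).integrable one_le_two
  have hmart : Martingale S ℱ μ := by
    refine martingale_of_condExp_sub_eq_zero_nat hSmeas hSint fun n => ?_
    rw [hSsucc, add_sub_cancel_left]
    exact hmean n
  -- Orthogonality of the increments makes the second moments of the partial sums additive.
  have hcross : ∀ n, ∫ ω, S n ω * η n ω ∂μ = 0 := fun n => by
    have hint : Integrable (S n * η n) μ := (hSL2 n).integrable_mul (hL2 n)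
    have h1 := condExp_mul_of_stronglyMeasurable_left (hSmeas n) hint
      ((hL2 n).integrable one_le_two)
    have h2 : μ[S n * η n | ℱ n] =ᵐ[μ] 0 := by
      filter_upwards [h1, hmean n] with ω hω1 hω2
      simp [hω1, hω2]
    have h3 := integral_condExp (ℱ.le n) (μ := μ) (f := S n * η n)
    rw [integral_congr_ae h2] at h3
    simpa using h3.symm
  have hSsq : ∀ n, ∫ ω, S n ω ^ 2 ∂μ ≤ ∑ k ∈ Finset.range n, (c k : ℝ) := by
    intro n
    induction n with
    | zero => simp [hS]
    | succ n ih =>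
      have hint : Integrable (fun ω => S n ω * η n ω) μ := (hSL2 n).integrable_mul (hL2 n)
      have heq : ∫ ω, S (n + 1) ω ^ 2 ∂μ =
          ∫ ω, S n ω ^ 2 ∂μ + 2 * ∫ ω, S n ω * η n ω ∂μ + ∫ ω, η n ω ^ 2 ∂μ := by
        rw [← integral_const_mul, ← integral_add (hSL2 n).integrable_sq (hint.const_mul 2),
          ← integral_add (f := fun ω => S n ω ^ 2 + 2 * (S n ω * η n ω))
            ((hSL2 n).integrable_sq.add (hint.const_mul 2)) (hL2 n).integrable_sq]
        congr 1
        ext ω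
        simp only [hSsucc, Pi.add_apply]
        ring
      rw [heq, hcross, Finset.sum_range_succ]
      linarith [hsq n]
  have hbound : ∀ n, eLpNorm (S n) 1 μ ≤
      ((μ.real Set.univ + ∑' k, (c k : ℝ)).toNNReal : ℝ≥0) := fun n => by
    rw [eLpNorm_one_eq_lintegral_enorm, ← ofReal_integral_norm_eq_lintegral_enorm (hSint n)]
    refine ENNReal.ofReal_le_ofReal ?_
    have h1 : ∫ ω, ‖S n ω‖ ∂μ ≤ ∫ ω, (1 + S n ω ^ 2) ∂μ := by
      refine integral_mono (hSint n).norm ((integrable_const 1).add (hSL2 n).integrable_sq)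
        fun ω => ?_
      change |S n ω| ≤ 1 + S n ω ^ 2
      nlinarith [sq_abs (S n ω), sq_nonneg (|S n ω| - 1)]
    rw [integral_add (integrable_const 1) (hSL2 n).integrable_sq, integral_const, smul_eq_mul,
      mul_one] at h1
    have h2 : ∑ k ∈ Finset.range n, (c k : ℝ) ≤ ∑' k, (c k : ℝ) :=
      (NNReal.summable_coe.2 hcsum).sum_le_tsum (Finset.range n) fun k _ => (c k).2
    exact h1.trans (add_le_add_right ((hSsq n).trans h2) _)
  exact hmart.submartingale.exists_ae_tendsto_of_bdd hbound

end MartingaleDifference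

/-! ### Almost sure reduction of the subgradient method to stochastic approximation. -/

section StochasticSubgradient

variable {Ω : Type*} {m : MeasurableSpace Ω} {μ : Measure Ω} {d : ℕ}
  {f : EuclideanSpace ℝ (Fin d) → ℝ} {ℱ : Filtration ℕ m} {α : ℕ → ℝ}
  {x y ξ : ℕ → Ω → EuclideanSpace ℝ (Fin d)}

theorem comap_le_pastSigma (x y ξ : ℕ → Ω → EuclideanSpace ℝ (Fin d)) {j k : ℕ} (hjk : j < k) :
    (borel (EuclideanSpace ℝ (Fin d))).comap (x j) ⊔
      (borel (EuclideanSpace ℝ (Fin d))).comap (y j) ⊔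
      (borel (EuclideanSpace ℝ (Fin d))).comap (ξ j) ≤ pastSigma x y ξ k :=
  le_iSup₂ (f := fun j (_ : j < k) => (borel (EuclideanSpace ℝ (Fin d))).comap (x j) ⊔
      (borel (EuclideanSpace ℝ (Fin d))).comap (y j) ⊔
      (borel (EuclideanSpace ℝ (Fin d))).comap (ξ j)) j hjk

namespace IsStochasticSubgradientMethod

theorem measurable_past (h : IsStochasticSubgradientMethod μ f ℱ α x y ξ) {j k : ℕ}
    (hjk : j < k) : Measurable[ℱ k] (x j) ∧ Measurable[ℱ k] (y j) ∧ Measurable[ℱ k] (ξ j) := by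
  have hle := (comap_le_pastSigma x y ξ hjk).trans (h.past_le k)
  rw [← BorelSpace.measurable_eq] at hle
  refine ⟨?_, ?_, ?_⟩ <;> rw [measurable_iff_comap_le]
  · exact (le_sup_left.trans le_sup_left).trans hle
  · exact (le_sup_right.trans le_sup_left).trans hle
  · exact le_sup_right.trans hle

theorem measurable_iterate_succ (h : IsStochasticSubgradientMethod μ f ℱ α x y ξ) (k : ℕ) :
    Measurable[ℱ (k + 1)] (x (k + 1)) := by
  obtain ⟨hx, hy, hξ⟩ := h.measurable_past k.lt_succ_self
  have : x (k + 1) = x k - α k • (y k + ξ k) := funext fun ω => h.step k ω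
  rw [this]
  exact hx.sub ((hy.add hξ).const_smul (α k))

/-- The noise series, restricted to the steps taken from the ball of radius `R`, converges almost
surely. -/
theorem ae_exists_tendsto_sum_indicator [IsFiniteMeasure μ]
    (h : IsStochasticSubgradientMethod μ f ℱ α x y ξ) (R : ℝ) (i : Fin d) :
    ∀ᵐ ω ∂μ, ∃ l, Tendsto (fun n => ∑ k ∈ Finset.range n,
      {ω | ‖x (k + 1) ω‖ ≤ R}.indicator (fun ω => α (k + 1) * ξ (k + 1) ω i) ω) atTop (𝓝 l) := by
  obtain ⟨p, hp, hmom⟩ := h.second_moment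
  obtain ⟨P, hP⟩ := hp (Metric.closedBall 0 R) Metric.isBounded_closedBall
  -- The shift by one drops the initial step: the past at stage `0` is trivial, so `x 0` need not be
  -- `ℱ 0`-measurable, whereas `x (k + 1)` is determined by the past at stage `k + 1`.
  set 𝒢 : Filtration ℕ m := ⟨fun k => ℱ (k + 1), fun _ _ hij => ℱ.mono (Nat.succ_le_succ hij),
    fun k => ℱ.le _⟩ with h𝒢
  have hA : ∀ k, MeasurableSet[ℱ (k + 1)] {ω | ‖x (k + 1) ω‖ ≤ R} := fun k => by
    have := h.measurable_iterate_succ k (Metric.isClosed_closedBall (x := 0) (ε := R)).measurableSet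
    simpa [Set.preimage] using this
  refine ae_exists_tendsto_sum_of_martingale_difference (ℱ := 𝒢)
    (c := fun k => ‖α (k + 1)‖₊ ^ 2 * (P * (μ Set.univ).toNNReal)) (fun k => ?_) (fun k => ?_) ?_
    fun k => ?_
  · refine Measurable.stronglyMeasurable ?_
    refine Measurable.indicator ?_ (ℱ.mono (Nat.le_succ _) _ (hA k))
    have hξ := (h.measurable_past (Nat.lt_succ_self (k + 1))).2.2
    exact (((EuclideanSpace.proj i : EuclideanSpace ℝ (Fin d) →L[ℝ] ℝ).continuous.measurable).comp
      hξ).const_mul _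
  · have hle := ℱ.le (k + 1)
    calc ∫⁻ ω, ‖{ω | ‖x (k + 1) ω‖ ≤ R}.indicator
          (fun ω => α (k + 1) * ξ (k + 1) ω i) ω‖ₑ ^ 2 ∂μ
        ≤ ∫⁻ ω, {ω | ‖x (k + 1) ω‖ ≤ R}.indicator
          (fun ω => (‖α (k + 1)‖ₑ ^ 2) * ‖ξ (k + 1) ω‖ₑ ^ 2) ω ∂μ := by
          refine lintegral_mono fun ω => ?_
          by_cases hω : ω ∈ {ω | ‖x (k + 1) ω‖ ≤ R}
          · simp only [Set.indicator_of_mem hω]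
            rw [enorm_mul, mul_pow]
            gcongr
            rw [enorm_le_iff_norm_le]
            exact PiLp.norm_apply_le _ _
          · simp [Set.indicator_of_notMem hω]
      _ = ‖α (k + 1)‖ₑ ^ 2 * ∫⁻ ω in {ω | ‖x (k + 1) ω‖ ≤ R}, ‖ξ (k + 1) ω‖ₑ ^ 2 ∂μ := by
          rw [lintegral_indicator (hle _ (hA k)), lintegral_const_mul' _ _ (by simp)]
      _ = ‖α (k + 1)‖ₑ ^ 2 * ∫⁻ ω in {ω | ‖x (k + 1) ω‖ ≤ R},
            condLExp (ℱ (k + 1)) μ (fun ω' => ‖ξ (k + 1) ω'‖ₑ ^ 2) ω ∂μ := by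
          rw [setLIntegral_condLExp hle _ _ (hA k)]
      _ ≤ ‖α (k + 1)‖ₑ ^ 2 * ∫⁻ _ in {ω | ‖x (k + 1) ω‖ ≤ R}, (P : ℝ≥0∞) ∂μ := by
          gcongr 1
          refine setLIntegral_mono_ae measurable_const.aemeasurable ?_
          filter_upwards [hmom (k + 1)] with ω hω hxR
          refine hω.trans (ENNReal.coe_le_coe.2 (hP ⟨_, ?_, rfl⟩))
          simpa using hxR
      _ ≤ ‖α (k + 1)‖ₑ ^ 2 * (P * μ Set.univ) := by
          rw [setLIntegral_const]
          gcongr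
          exact Set.subset_univ _
      _ = _ := by
          push_cast
          rw [ENNReal.coe_toNNReal (measure_ne_top μ _)]
          rfl
  · refine Summable.mul_right _ (NNReal.summable_coe.1 ?_)
    simpa using (summable_nat_add_iff 1).2 h.stepSize.sq_summable
  · set L : EuclideanSpace ℝ (Fin d) →L[ℝ] ℝ := α (k + 1) • EuclideanSpace.proj i
    have hint := L.integrable_comp (h.integrable (k + 1))
    have h1 := L.comp_condExp_comm (m := ℱ (k + 1)) (h.integrable (k + 1))
    have h2 := condExp_indicator (m := ℱ (k + 1)) hint (hA k)
    change μ[{ω | ‖x (k + 1) ω‖ ≤ R}.indicator (L ∘ ξ (k + 1)) | ℱ (k + 1)] =ᵐ[μ] 0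
    filter_upwards [h1, h2, h.mean_zero (k + 1)] with ω hω1 hω2 hω3
    refine hω2.trans ?_
    by_cases hω : ω ∈ {ω | ‖x (k + 1) ω‖ ≤ R}
    · rw [Set.indicator_of_mem hω]
      refine hω1.symm.trans ?_
      simp [hω3]
    · rw [Set.indicator_of_notMem hω, Pi.zero_apply]

/-- A bounded path stays in a ball of some integer radius, where the truncated series coincides with
the true one; countably many radii and coordinates leave one null set. -/
theorem ae_exists_tendsto_noise [IsFiniteMeasure μ]
    (h : IsStochasticSubgradientMethod μ f ℱ α x y ξ) :
    ∀ᵐ ω ∂μ, ∃ v, Tendsto (fun n => ∑ k ∈ Finset.range n, α k • ξ k ω) atTop (𝓝 v) := by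
  have hall : ∀ᵐ ω ∂μ, ∀ (R : ℕ) (i : Fin d), ∃ l, Tendsto (fun n => ∑ k ∈ Finset.range n,
      {ω | ‖x (k + 1) ω‖ ≤ R}.indicator (fun ω => α (k + 1) * ξ (k + 1) ω i) ω) atTop (𝓝 l) :=
    ae_all_iff.2 fun R => ae_all_iff.2 fun i => h.ae_exists_tendsto_sum_indicator R i
  filter_upwards [hall, h.bounded_x] with ω hω ⟨C, hC⟩
  obtain ⟨R, hR⟩ := exists_nat_ge C
  choose l hl using hω R
  refine ⟨WithLp.toLp 2 l + α 0 • ξ 0 ω, ?_⟩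
  rw [← tendsto_add_atTop_iff_nat 1]
  simp only [Finset.sum_range_succ']
  refine Tendsto.add_const _ ?_
  have hpi : Tendsto (fun n i => ∑ k ∈ Finset.range n, α (k + 1) * ξ (k + 1) ω i) atTop (𝓝 l) := by
    refine tendsto_pi_nhds.2 fun i => (hl i).congr fun n => Finset.sum_congr rfl fun k _ => ?_
    exact Set.indicator_of_mem (s := {ω | ‖x (k + 1) ω‖ ≤ R})
      (show ω ∈ {ω | ‖x (k + 1) ω‖ ≤ R} from (hC _).trans hR)
      fun ω => α (k + 1) * ξ (k + 1) ω i
  refine (((PiLp.continuous_toLp 2 fun _ : Fin d => ℝ).tendsto l).comp hpi).congr fun n => ?_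
  ext i
  simp

theorem ae_isStochasticApproximation [IsFiniteMeasure μ] (hf : LocallyLipschitz f)
    (h : IsStochasticSubgradientMethod μ f ℱ α x y ξ) :
    ∀ᵐ ω ∂μ, IsStochasticApproximation (fun z => -clarkeSubdifferential f z) α
      (fun k => x k ω) (fun k => -y k ω) (fun k => -ξ k ω) := by
  filter_upwards [h.ae_exists_tendsto_noise, h.bounded_x] with ω ⟨v, hv⟩ ⟨C, hC⟩
  obtain ⟨K, hK⟩ := hf.exists_lipschitzOnWith_closedBall (C + 1)
  refine ⟨fun k => ?_, ⟨C, hC⟩, ⟨K, fun k => ?_⟩, h.stepSize, ⟨-v, ?_⟩, fun κ a hκ hx => ?_⟩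
  · rw [h.step, ← neg_add, smul_neg, sub_eq_add_neg]
  · rw [norm_neg]
    exact norm_le_of_mem_clarkeSubdifferential hK (by linarith [hC k]) (h.subgradient k ω)
  · simpa using hv.neg
  · refine (tendsto_infDist_average_clarkeSubdifferential hf hx
      fun j => h.subgradient (κ j) ω).congr fun n => ?_
    rw [Finset.sum_neg_distrib, smul_neg, ← Set.image_neg_eq_neg,
      ← Metric.infDist_image (LinearIsometryEquiv.neg ℝ).isometry]
    rfl

end IsStochasticSubgradientMethod

end StochasticSubgradient

theorem mainTheorem9 {d : ℕ} (f : EuclideanSpace ℝ (Fin d) → ℝ) (hf : LocallyLipschitz f)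
    (hreg : ∀ x, SubdifferentiallyRegularAt f x) (hsard : Dense (criticalValues f)ᶜ) :
    (∀ (α : ℕ → ℝ) (x y ξ : ℕ → EuclideanSpace ℝ (Fin d)),
      IsStochasticApproximation (fun z => -clarkeSubdifferential f z) α x y ξ →
        (∀ z, MapClusterPt z atTop x → IsClarkeCritical f z) ∧
          ∃ L : ℝ, Tendsto (fun k => f (x k)) atTop (𝓝 L)) ∧
    (∀ (Ω : Type*) (m : MeasurableSpace Ω) (μ : Measure Ω) (_ : IsProbabilityMeasure μ)
      (ℱ : Filtration ℕ m) (α : ℕ → ℝ) (x y ξ : ℕ → Ω → EuclideanSpace ℝ (Fin d)),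
      IsStochasticSubgradientMethod μ f ℱ α x y ξ →
        ∀ᵐ ω ∂μ, (∀ z, MapClusterPt z atTop (fun k => x k ω) → IsClarkeCritical f z) ∧
          ∃ L : ℝ, Tendsto (fun k => f (x k ω)) atTop (𝓝 L)) := by
  refine ⟨fun α x y ξ h => h.isClarkeCritical_and_exists_tendsto hf hreg hsard,
    fun Ω m μ _ ℱ α x y ξ h => ?_⟩
  filter_upwards [h.ae_isStochasticApproximation hf] with ω hω
  exact hω.isClarkeCritical_and_exists_tendsto hf hreg hsard
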